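/- Let $\mathbb K$ be a field, $R=\mathbb K[x_0,\dots,x_n]$ and $T=\mathbb K[z_1,\dots,z_s]$ standard graded polynomial rings, $f_1,\dots,f_s\in R$ forms (homogeneous polynomials), and $a,m_1,\dots,m_s$ positive integers with $a\le m_1+\cdots+m_s$. For elements $g_1,\dots,g_s$ of a commutative ring let $$I_a(g_1^{m_1}\cdots g_s^{m_s})=\bigl\langle g_1^{k_1}\cdots g_s^{k_s} : 0\le k_i\le m_i \text{ for all } i,\ k_1+\cdots+k_s=a\bigr\rangle .$$ The family $\mathcal F=\{f_1,\dots,f_s\}$ is called $c$-generic if any at most $c+1$ of the $f_i$ (with distinct indices) form a regular sequence, and generic if it is $n$-generic. It is called a strongly generic set of $d$-forms if all $f_i$ have degree $d$, $\mathcal F$ is generic, and $\dim_{\mathbb K}(\mathbb K f_1+\cdots+\mathbb K f_s)=n+1$. An ideal $I$ of $R$ has c.i. quotients if it has a generating set of forms, with a total order $h_1>\cdots>h_r$ on it, such that for every $1\le i\le r-1$ the colon ideal $\langle h_1,\dots,h_i\rangle : h_{i+1}$ is a complete intersection ideal, i.e. a proper ideal generated by a regular sequence of forms; it has $d$-c.i.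 quotients if this can be done so that each of these colon ideals is generated by a regular sequence of forms of degree $d$. Then: (a) If $\mathcal F$ is a strongly generic set of $d$-forms, then $I_a(f_1^{m_1}\cdots f_s^{m_s})$ has $d$-c.i. quotients. (b) If $c$ is a non-negative integer with $\operatorname{pd}_T I_a(z_1^{m_1}\cdots z_s^{m_s})\le c\le n$ and $\mathcal F$ is $c$-generic, then $I_a(f_1^{m_1}\cdots f_s^{m_s})$ has c.i. quotients. If in addition all $f_i$ have degree $d$, then $I_a(f_1^{m_1}\cdots f_s^{m_s})$ has $d$-c.i. quotients. -/

import Mathlib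

open CategoryTheory

noncomputable section

/-- The `a`-fold product ideal `I_a(f_1^{m_1} ⋯ f_s^{m_s})` of a commutative ring: it is generated by
all products `f_1^{k_1} ⋯ f_s^{k_s}` with `0 ≤ k_i ≤ m_i` and `k_1 + ⋯ + k_s = a`. -/
def foldProductIdeal {R : Type*} [CommRing R] {s : ℕ}
    (f : Fin s → R) (m : Fin s → ℕ) (a : ℕ) : Ideal R :=
  Ideal.span {g : R | ∃ k : Fin s → ℕ,
    (∀ i, k i ≤ m i) ∧ ∑ i, k i = a ∧ g = ∏ i, f i ^ k i}

/-- A polynomial that is homogeneous of some degree. -/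
def IsForm {σ K : Type*} [Field K] (p : MvPolynomial σ K) : Prop :=
  ∃ e : ℕ, p.IsHomogeneous e

/-- The family `f_1, …, f_s` is `c`-generic: any at most `c + 1` of its members (with distinct
indices, in whatever order they are listed) form a regular sequence. A regular sequence
generates a proper ideal, so for forms all degrees are positive and the order is immaterial. -/
def IsCGeneric {R : Type*} [CommRing R] {s : ℕ} (c : ℕ) (f : Fin s → R) : Prop :=
  ∀ l : List (Fin s), l.Nodup → l.length ≤ c + 1 →
    RingTheory.Sequence.IsRegular R (l.map f)

/-- A strongly generic family of `d`-forms in `n + 1` variables: forms of degree `d` that are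
generic (i.e. `n`-generic) and span a `K`-linear space of dimension `n + 1`. -/
structure IsStronglyGeneric {K : Type*} [Field K] {n s : ℕ} (d : ℕ)
    (f : Fin s → MvPolynomial (Fin (n + 1)) K) : Prop where
  isHomogeneous : ∀ i, (f i).IsHomogeneous d
  generic : IsCGeneric n f
  finrank_span : Module.finrank K (Submodule.span K (Set.range f)) = n + 1

/-- A (homogeneous) complete intersection ideal: a proper ideal generated by a regular sequence of
forms. The empty sequence, which generates the zero ideal, is allowed. -/
def IsCompleteIntersection {σ K : Type*} [Field K] (J : Ideal (MvPolynomial σ K)) : Prop :=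
  ∃ l : List (MvPolynomial σ K), (∀ p ∈ l, IsForm p) ∧
    RingTheory.Sequence.IsRegular (MvPolynomial σ K) l ∧ Ideal.ofList l = J

/-- A complete intersection ideal of degree `d`: it is generated by a regular sequence of forms
all of which have degree `d`. -/
def IsCompleteIntersectionOfDegree {σ K : Type*} [Field K] (d : ℕ)
    (J : Ideal (MvPolynomial σ K)) : Prop :=
  ∃ l : List (MvPolynomial σ K), (∀ p ∈ l, p.IsHomogeneous d) ∧
    RingTheory.Sequence.IsRegular (MvPolynomial σ K) l ∧ Ideal.ofList l = J

/-- `I` has complete intersection quotients: it has a finite generating set of forms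
`h_0 > h_1 > ⋯ > h_{r-1}` such that for every `0 < i < r` the colon ideal
`⟨h_0, …, h_{i-1}⟩ : h_i` is a complete intersection ideal. -/
def HasCIQuotients {σ K : Type*} [Field K] (I : Ideal (MvPolynomial σ K)) : Prop :=
  ∃ (r : ℕ) (h : Fin r → MvPolynomial σ K),
    Function.Injective h ∧ (∀ i, IsForm (h i)) ∧ Ideal.span (Set.range h) = I ∧
    ∀ i : Fin r, 0 < i.val →
      IsCompleteIntersection ((Ideal.span (h '' {j | j < i})).colon {h i})

/-- `I` has `d`-complete intersection quotients: as in `HasCIQuotients`, and every one of the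
colon ideals is a complete intersection ideal of the same degree `d`. -/
def HasCIQuotientsOfDegree {σ K : Type*} [Field K] (d : ℕ)
    (I : Ideal (MvPolynomial σ K)) : Prop :=
  ∃ (r : ℕ) (h : Fin r → MvPolynomial σ K),
    Function.Injective h ∧ (∀ i, IsForm (h i)) ∧ Ideal.span (Set.range h) = I ∧
    ∀ i : Fin r, 0 < i.val →
      IsCompleteIntersectionOfDegree d ((Ideal.span (h '' {j | j < i})).colon {h i})

end

/-! List the products `f^u` with lexicographically larger exponents first. If `u j < m j` and some
`l > j` has `u l > 0`, moving a unit from `l` to `j` gives an earlier product, so `f j * f^u` lies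
in the earlier ideal. Call such `j` raisable and let `J` be the set of them. If `card J ≤ c` and the
family is `c`-generic, cancelling powers one index at a time shows that the colon ideal is exactly
`(f j : j ∈ J)`.

For (b), the projective dimension bounds `card J`. Take `l` beyond `max J` with `u l > 0`. The
monomial `z^u / z_l` is nonzero modulo `I_a` for degree reasons, yet is killed by the `card J + 1`
variables indexed by `J ∪ {l}`. As `T ⧸ I_a` has projective dimension at most `c + 1`, this forces
`card J ≤ c`.

For (a), if `card J > n`, choose `n + 1` raisable indices; those `f j` form a regular sequence `y`
spanning all the `f i` over `K`. All products are then degree `a` forms in `y` with coefficients in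
`K`, and quasi-regularity shows that either `f^u` lies in the earlier ideal or the colon ideal is
`(y)`. Redundant products are discarded. -/

/-! ### Cancellation modulo generic families -/

/-- Each member of the family is a nonzerodivisor modulo any at most `c` others. -/
def IsRegularUpTo {R ι : Type*} [CommRing R] (c : ℕ) (f : ι → R) : Prop :=
  ∀ (S : Finset ι) (i : ι), i ∉ S → S.card ≤ c → ∀ g : R,
    g * f i ∈ Ideal.span (f '' S) → g ∈ Ideal.span (f '' S)

theorem ofList_map_eq_span {R ι : Type*} [CommRing R] (f : ι → R) (l : List ι) :
    Ideal.ofList (l.map f) = Ideal.span (f '' {i | i ∈ l}) := by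
  unfold Ideal.ofList
  congr 1
  ext r
  simp

theorem IsCGeneric.isRegularUpTo {R : Type*} [CommRing R] {s c : ℕ} {f : Fin s → R}
    (hf : IsCGeneric c f) : IsRegularUpTo c f := by
  intro S i hi hS g hg
  have h := (hf (S.toList ++ [i]) (by simp [List.nodup_append, S.nodup_toList, hi])
    (by simpa using hS)).regular_mod_prev S.card (by simp)
  rw [isSMulRegular_quotient_iff_mem_of_smul_mem] at h
  have e : (Ideal.ofList (((S.toList ++ [i]).map f).take S.card) • ⊤ : Submodule R R) =
      Ideal.span (f '' S) := by
    rw [smul_eq_mul, Ideal.mul_top, ← List.map_take, List.take_left' (by simp),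
      ofList_map_eq_span]
    simp
  rw [e] at h
  apply h
  simpa [mul_comm] using hg

theorem IsCGeneric.span_ne_top {R : Type*} [CommRing R] {s c : ℕ} {f : Fin s → R}
    (hf : IsCGeneric c f) {S : Finset (Fin s)} (hS : S.card ≤ c + 1) :
    Ideal.span (f '' S) ≠ ⊤ := by
  have h := (hf S.toList S.nodup_toList (by simpa using hS)).top_ne_smul
  rw [smul_eq_mul, Ideal.mul_top, ofList_map_eq_span] at h
  simpa using h.symm

theorem IsRegularUpTo.mem_of_mul_pow {R ι : Type*} [CommRing R] {c : ℕ} {f : ι → R}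
    (hf : IsRegularUpTo c f) {S : Finset ι} {i : ι} (hi : i ∉ S) (hS : S.card ≤ c) {g : R} (k : ℕ)
    (hg : g * f i ^ k ∈ Ideal.span (f '' S)) : g ∈ Ideal.span (f '' S) := by
  induction k with
  | zero => simpa using hg
  | succ k ih => exact ih (hf S i hi hS _ (by rwa [mul_assoc, ← pow_succ]))

theorem IsRegularUpTo.mem_of_mul_prod {R ι : Type*} [CommRing R] {c : ℕ} {f : ι → R}
    (hf : IsRegularUpTo c f) {S : Finset ι} (hS : S.card ≤ c) (u : ι → ℕ) (T : Finset ι)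
    (hT : Disjoint T S) {g : R} (hg : g * ∏ i ∈ T, f i ^ u i ∈ Ideal.span (f '' S)) :
    g ∈ Ideal.span (f '' S) := by
  classical
  induction T using Finset.induction_on with
  | empty => simpa using hg
  | insert i T hi ih =>
    rw [Finset.disjoint_insert_left] at hT
    refine ih hT.2 (hf.mem_of_mul_pow hT.1 hS (u i) ?_)
    rwa [Finset.prod_insert hi, mul_comm (f i ^ u i), ← mul_assoc] at hg

/-! ### Colon by a power product, along a list of indices -/

/-- The ideal generated by the power products of `f j`, `j ∈ l`, that exceed the exponent `u`
lexicographically. -/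
def lexIdeal {R ι : Type*} [CommRing R] (f : ι → R) (u : ι → ℕ) : List ι → Ideal R
  | [] => ⊥
  | j :: t => Ideal.span {f j ^ (u j + 1)} ⊔ Ideal.span {f j ^ u j} * lexIdeal f u t

/-- Both summands of `lexIdeal` at `j` are divisible by `f j ^ u j`. Cancelling this power modulo
`S` leaves the same problem for the tail, with `f j` moved into `S`. -/
theorem IsRegularUpTo.mem_of_mul_mem_lexIdeal {R ι : Type*} [CommRing R] [DecidableEq ι] {c : ℕ}
    {f : ι → R} (hf : IsRegularUpTo c f) (u : ι → ℕ) (l : List ι) (S : Finset ι) (hl : l.Nodup)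
    (hlS : ∀ i ∈ l, i ∉ S) (hc : S.card + l.length ≤ c + 1) (g : R)
    (hg : g * (l.map fun i => f i ^ u i).prod ∈ Ideal.span (f '' S) ⊔ lexIdeal f u l) :
    g ∈ Ideal.span (f '' (S ∪ l.toFinset : Finset ι)) := by
  induction l generalizing S g with
  | nil => simpa [lexIdeal] using hg
  | cons j t ih =>
    simp only [List.nodup_cons, List.mem_cons, forall_eq_or_imp, List.length_cons] at hl hlS hc
    have e : S ∪ (j :: t).toFinset = insert j S ∪ t.toFinset := by
      ext x; simp
    rw [e]
    refine ih (insert j S) hl.2 ?_ ?_ g ?_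
    · intro i hi
      simp only [Finset.mem_insert, not_or]
      exact ⟨fun h => hl.1 (h ▸ hi), hlS.2 i hi⟩
    · rw [Finset.card_insert_of_notMem hlS.1]; omega
    · obtain ⟨q, hq, r, hr, hqr⟩ := Submodule.mem_sup.1 hg
      obtain ⟨x, hx, y, hy, hxy⟩ := Submodule.mem_sup.1 hr
      obtain ⟨x', rfl⟩ := Ideal.mem_span_singleton.1 hx
      obtain ⟨y', hy', rfl⟩ := Ideal.mem_span_singleton_mul.1 hy
      have h1 : (g * (t.map fun i => f i ^ u i).prod - f j * x' - y') * f j ^ u j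
          ∈ Ideal.span (f '' S) := by
        convert hq using 1
        simp only [List.map_cons, List.prod_cons] at hqr
        linear_combination -hqr - hxy
      have h2 := hf.mem_of_mul_pow hlS.1 (by omega) _ h1
      have h3 : g * (t.map fun i => f i ^ u i).prod =
          ((g * (t.map fun i => f i ^ u i).prod - f j * x' - y') + f j * x') + y' := by ring
      rw [h3]
      refine Submodule.add_mem_sup (Ideal.add_mem _ ?_ ?_) hy'
      · exact Ideal.span_mono (Set.image_mono (by simp)) h2
      · exact Ideal.mul_mem_right _ _ (Ideal.subset_span ⟨j, by simp, rfl⟩)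

theorem prod_mem_lexIdeal {R ι : Type*} [CommRing R] [LinearOrder ι] (f : ι → R) (u v : ι → ℕ)
    (l : List ι) (hl : l.Pairwise (· < ·)) (i : ι) (hi : i ∈ l) (hiv : u i < v i)
    (hv : ∀ j ∈ l, j < i → u j ≤ v j) : (l.map fun i => f i ^ v i).prod ∈ lexIdeal f u l := by
  induction l with
  | nil => simp at hi
  | cons j t ih =>
    rw [List.pairwise_cons] at hl
    rw [List.map_cons, List.prod_cons, lexIdeal]
    rcases List.mem_cons.1 hi with rfl | hit
    · exact Ideal.mem_sup_left (Ideal.mul_mem_right _ _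
        (Ideal.mem_span_singleton.2 (pow_dvd_pow _ hiv)))
    · exact Ideal.mem_sup_right (Ideal.mul_mem_mul
        (Ideal.mem_span_singleton.2 (pow_dvd_pow _ (hv j (by simp) (hl.1 i hit))))
        (ih hl.2 hit fun k hk => hv k (by simp [hk])))

/-! ### Discarding redundant generators -/

theorem span_image_filter_notMem_eq {R α : Type*} [CommRing R] [LinearOrder α] (U : Finset α)
    (g : α → R) (p : α → Prop) (hp : ∀ u v, v < u → p u → p v) :
    Ideal.span (g '' {u | (u ∈ U ∧ g u ∉ Ideal.span (g '' {v | v ∈ U ∧ v < u})) ∧ p u}) =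
      Ideal.span (g '' {u | u ∈ U ∧ p u}) := by
  refine le_antisymm (Ideal.span_mono (Set.image_mono fun u hu => ⟨hu.1.1, hu.2⟩)) ?_
  rw [Ideal.span_le]
  rintro _ ⟨u, ⟨hu, hpu⟩, rfl⟩
  -- Induct on the number of elements of `U` below `u`: a discarded generator is a combination of
  -- earlier ones, already generated by the survivors.
  induction hn : (U.filter (· < u)).card using Nat.strong_induction_on generalizing u with
  | _ n ih =>
    by_cases hgu : g u ∈ Ideal.span (g '' {v | v ∈ U ∧ v < u})
    · refine (Ideal.span_le.2 ?_) hgu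
      rintro _ ⟨v, ⟨hv, hvu⟩, rfl⟩
      refine ih _ ?_ v hv (hp _ _ hvu hpu) rfl
      rw [← hn]
      refine Finset.card_lt_card (Finset.ssubset_iff_subset_ne.2 ⟨fun w hw => ?_, fun h => ?_⟩)
      · simp only [Finset.mem_filter] at hw ⊢
        exact ⟨hw.1, hw.2.trans hvu⟩
      · have : v ∈ U.filter (· < u) := by simp [hv, hvu]
        rw [← h] at this
        simp at this
    · exact Ideal.subset_span ⟨u, ⟨⟨hu, hgu⟩, hpu⟩, rfl⟩

/-- Generators indexed by a finite ordered set can be thinned out so that no generator lies in the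
ideal of the earlier ones, without changing the ideals generated by initial segments. -/
theorem exists_thinned_generators {R α : Type*} [CommRing R] [LinearOrder α] (U : Finset α)
    (g : α → R) (P : Ideal R → Prop)
    (hP : ∀ u ∈ U, g u ∉ Ideal.span (g '' {v | v ∈ U ∧ v < u}) →
      P ((Ideal.span (g '' {v | v ∈ U ∧ v < u})).colon {g u})) :
    ∃ (r : ℕ) (h : Fin r → R), Function.Injective h ∧ (∀ i, ∃ u ∈ U, h i = g u) ∧
      Ideal.span (Set.range h) = Ideal.span (g '' U) ∧
      ∀ i, P ((Ideal.span (h '' {j | j < i})).colon {h i}) := by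
  classical
  set V := U.filter fun u => g u ∉ Ideal.span (g '' {v | v ∈ U ∧ v < u}) with hV
  have hmem : ∀ i, V.orderEmbOfFin rfl i ∈ U ∧ g (V.orderEmbOfFin rfl i) ∉
      Ideal.span (g '' {v | v ∈ U ∧ v < V.orderEmbOfFin rfl i}) :=
    fun i => Finset.mem_filter.1 (V.orderEmbOfFin_mem rfl i)
  have himage : ∀ i, (fun j => g (V.orderEmbOfFin rfl j)) '' {j | j < i} =
      g '' {u | (u ∈ U ∧ g u ∉ Ideal.span (g '' {v | v ∈ U ∧ v < u})) ∧
        u < V.orderEmbOfFin rfl i} := by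
    intro i
    ext x
    constructor
    · rintro ⟨j, hj, rfl⟩
      exact ⟨_, ⟨hmem j, (V.orderEmbOfFin rfl).lt_iff_lt.2 hj⟩, rfl⟩
    · rintro ⟨u, ⟨hu, hui⟩, rfl⟩
      have : u ∈ Set.range (V.orderEmbOfFin rfl) := by
        rw [Finset.range_orderEmbOfFin]; simpa [hV] using hu
      obtain ⟨j, rfl⟩ := this
      exact ⟨j, (V.orderEmbOfFin rfl).lt_iff_lt.1 hui, rfl⟩
  have hspan : ∀ i, Ideal.span ((fun j => g (V.orderEmbOfFin rfl j)) '' {j | j < i}) =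
      Ideal.span (g '' {v | v ∈ U ∧ v < V.orderEmbOfFin rfl i}) := by
    intro i
    rw [himage, span_image_filter_notMem_eq U g (· < V.orderEmbOfFin rfl i)
      fun u v hvu hu => hvu.trans hu]
  refine ⟨V.card, fun i => g (V.orderEmbOfFin rfl i), ?_, ?_, ?_, ?_⟩
  · have key : ∀ i j, i < j → g (V.orderEmbOfFin rfl i) ≠ g (V.orderEmbOfFin rfl j) := by
      intro i j hij h
      refine (hmem j).2 (h ▸ Ideal.subset_span ⟨_, ⟨(hmem i).1, ?_⟩, rfl⟩)
      exact (V.orderEmbOfFin rfl).lt_iff_lt.2 hij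
    intro i j hij
    rcases lt_trichotomy i j with h | h | h
    · exact absurd hij (key i j h)
    · exact h
    · exact absurd hij.symm (key j i h)
  · exact fun i => ⟨_, (hmem i).1, rfl⟩
  · have h := span_image_filter_notMem_eq U g (fun _ => True) fun _ _ _ _ => trivial
    simp only [and_true] at h
    have e : Set.range (fun i => g (V.orderEmbOfFin rfl i)) =
        g '' {u | u ∈ U ∧ g u ∉ Ideal.span (g '' {v | v ∈ U ∧ v < u})} := by
      rw [← Function.comp_def, Set.range_comp, Finset.range_orderEmbOfFin]
      simp [hV]
    rw [e, h]
    rfl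
  · intro i
    rw [hspan]
    exact hP _ (hmem i).1 (hmem i).2

/-! ### Raisable indices and lexicographic colon ideals -/

/-- The exponent vectors of total degree `a` bounded by `m`. -/
def boundedExponents {s : ℕ} (m : Fin s → ℕ) (a : ℕ) : Finset (Fin s → ℕ) :=
  (Fintype.piFinset fun i => Finset.range (m i + 1)).filter fun u => ∑ i, u i = a

theorem mem_boundedExponents {s : ℕ} {m : Fin s → ℕ} {a : ℕ} {u : Fin s → ℕ} :
    u ∈ boundedExponents m a ↔ (∀ i, u i ≤ m i) ∧ ∑ i, u i = a := by
  simp [boundedExponents]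

/-- The ideal of the power products of `f` with exponent in `boundedExponents m a` lexicographically larger
than `u`. -/
def lexLargerIdeal {R : Type*} [CommRing R] {s : ℕ} (f : Fin s → R) (m : Fin s → ℕ) (a : ℕ)
    (u : Fin s → ℕ) : Ideal R :=
  Ideal.span ((fun v : Fin s → ℕ => ∏ i, f i ^ v i) ''
    {v | v ∈ boundedExponents m a ∧ toLex u < toLex v})

/-- The indices `j` for which an exponent unit can be moved to `j` from a later index. -/
def raisableIndices {s : ℕ} (m u : Fin s → ℕ) : Finset (Fin s) :=
  Finset.univ.filter fun j => u j < m j ∧ ∃ l, j < l ∧ 0 < u l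

theorem prod_pow_add_single {R ι : Type*} [CommRing R] [Fintype ι] [DecidableEq ι] (f : ι → R)
    (w : ι → ℕ) (j : ι) :
    ∏ i, f i ^ (w + Pi.single j 1 : ι → ℕ) i = f j * ∏ i, f i ^ w i := by
  simp only [Pi.add_apply, pow_add, Finset.prod_mul_distrib]
  rw [mul_comm, Finset.prod_eq_single (f := fun i => f i ^ (Pi.single j 1 : ι → ℕ) i) j]
  · simp
  · intro i _ hij
    simp [hij]
  · simp

theorem exists_eq_add_single {ι : Type*} [DecidableEq ι] {u : ι → ℕ} {l : ι} (hl : 0 < u l) :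
    ∃ w : ι → ℕ, u = w + Pi.single l 1 := by
  refine ⟨u - Pi.single l 1, ?_⟩
  ext i
  by_cases h : i = l
  · subst h; simp; omega
  · simp [h]

theorem add_single_mem_boundedExponents {s : ℕ} {m w : Fin s → ℕ} {a : ℕ} {j l : Fin s}
    (hw : w + Pi.single l 1 ∈ boundedExponents m a) (hjl : j ≠ l) (hj : w j < m j) :
    w + Pi.single j 1 ∈ boundedExponents m a := by
  rw [mem_boundedExponents] at hw ⊢
  refine ⟨fun i => ?_, by simpa [Finset.sum_add_distrib] using hw.2⟩
  have h1 := hw.1 i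
  by_cases h : i = j
  · subst h
    simpa [hjl] using hj
  · simp only [Pi.add_apply] at h1 ⊢
    simp [h]; omega

theorem mul_prod_mem_lexLargerIdeal {R : Type*} [CommRing R] {s : ℕ} (f : Fin s → R)
    {m : Fin s → ℕ} {a : ℕ} {u : Fin s → ℕ} (hu : u ∈ boundedExponents m a) {j : Fin s}
    (hj : j ∈ raisableIndices m u) : f j * ∏ i, f i ^ u i ∈ lexLargerIdeal f m a u := by
  simp only [raisableIndices, Finset.mem_filter, Finset.mem_univ, true_and] at hj
  obtain ⟨hjm, l, hjl, hl⟩ := hj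
  obtain ⟨w, rfl⟩ := exists_eq_add_single hl
  rw [prod_pow_add_single, mul_left_comm, ← prod_pow_add_single]
  refine Ideal.mul_mem_left _ _ (Ideal.subset_span ⟨_, ⟨add_single_mem_boundedExponents hu hjl.ne
    (by simpa [hjl.ne] using hjm), j, fun i hi => ?_, ?_⟩, rfl⟩)
  · simp [(show i < j from hi).ne, ((show i < j from hi).trans hjl).ne]
  · simp [hjl.ne]

/-- Any earlier exponent first exceeds `u` at a raisable index, so the `J`-part of its product
already lies in `lexIdeal f u l`. The factors outside `J` are cancelled at the end modulo `(f j : j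
∈ J)`. -/
theorem IsRegularUpTo.mem_span_of_mul_mem_lexLargerIdeal {R : Type*} [CommRing R] {s c : ℕ}
    {f : Fin s → R} (hf : IsRegularUpTo c f) {m : Fin s → ℕ} {a : ℕ} {u : Fin s → ℕ}
    (hu : u ∈ boundedExponents m a) (hc : (raisableIndices m u).card ≤ c) {g : R}
    (hg : g * ∏ i, f i ^ u i ∈ lexLargerIdeal f m a u) :
    g ∈ Ideal.span (f '' raisableIndices m u) := by
  set J := raisableIndices m u with hJ
  set l := J.sort (· ≤ ·) with hl
  have hlJ : l.toFinset = J := J.sort_toFinset _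
  have hprodl : ∀ v : Fin s → ℕ, (l.map fun i => f i ^ v i).prod = ∏ i ∈ J, f i ^ v i := by
    intro v
    rw [← hlJ, List.prod_toFinset _ (J.sort_nodup _)]
  have hle : lexLargerIdeal f m a u ≤ lexIdeal f u l := by
    rw [lexLargerIdeal, Ideal.span_le]
    rintro _ ⟨v, ⟨hv, i, hi, hiv⟩, rfl⟩
    simp only at hi hiv
    rw [mem_boundedExponents] at hu hv
    have hiJ : i ∈ J := by
      rw [hJ, raisableIndices, Finset.mem_filter]
      refine ⟨Finset.mem_univ _, hiv.trans_le (hv.1 i), ?_⟩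
      -- If `u` vanished beyond `i`, then `u ≤ v` everywhere with strict inequality at `i`, against
      -- the equal totals.
      by_contra! h
      have : ∑ k, u k < ∑ k, v k := by
        refine Finset.sum_lt_sum (fun k _ => ?_) ⟨i, Finset.mem_univ _, hiv⟩
        rcases lt_trichotomy k i with hk | rfl | hk
        · exact (hi k hk).le
        · exact hiv.le
        · have := h k hk; omega
      omega
    have := prod_mem_lexIdeal f u v l (J.sortedLT_sort.pairwise) i (by simpa [hl] using hiJ) hiv
      fun j _ hji => (hi j hji).le
    rw [hprodl] at this
    show ∏ i, f i ^ v i ∈ _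
    rw [← Finset.prod_mul_prod_compl J]
    exact Ideal.mul_mem_right _ _ this
  have h1 : (g * ∏ i ∈ Jᶜ, f i ^ u i) * (l.map fun i => f i ^ u i).prod ∈
      Ideal.span (f '' (∅ : Finset (Fin s))) ⊔ lexIdeal f u l := by
    refine Ideal.mem_sup_right (hle ?_)
    rw [hprodl]
    convert hg using 1
    rw [← Finset.prod_mul_prod_compl J]
    ring
  have h2 := hf.mem_of_mul_mem_lexIdeal u l ∅ (J.sort_nodup _) (by simp)
    (by simp [hl]; omega) _ h1
  rw [hlJ, Finset.empty_union] at h2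
  exact hf.mem_of_mul_prod hc u Jᶜ disjoint_compl_left h2

theorem foldProductIdeal_eq_span_image {R : Type*} [CommRing R] {s : ℕ} (f : Fin s → R)
    (m : Fin s → ℕ) (a : ℕ) : foldProductIdeal f m a =
      Ideal.span ((fun v : Fin s → ℕ => ∏ i, f i ^ v i) '' boundedExponents m a) := by
  unfold foldProductIdeal
  congr 1
  ext g
  simp only [Set.mem_ofPred_eq, Set.mem_image, Finset.mem_coe, mem_boundedExponents]
  exact ⟨fun ⟨k, h1, h2, h3⟩ => ⟨k, ⟨h1, h2⟩, h3.symm⟩, fun ⟨k, ⟨h1, h2⟩, h3⟩ => ⟨k, h1, h2, h3.symm⟩⟩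

theorem exists_generators_of_colon {R : Type*} [CommRing R] {s : ℕ} (f : Fin s → R)
    (m : Fin s → ℕ) (a : ℕ) (P : Ideal R → Prop)
    (hP : ∀ u ∈ boundedExponents m a, ∏ i, f i ^ u i ∉ lexLargerIdeal f m a u →
      P ((lexLargerIdeal f m a u).colon {∏ i, f i ^ u i})) :
    ∃ (r : ℕ) (h : Fin r → R), Function.Injective h ∧ (∀ i, ∃ u : Fin s → ℕ, h i = ∏ j, f j ^ u j) ∧
      Ideal.span (Set.range h) = foldProductIdeal f m a ∧
      ∀ i, P ((Ideal.span (h '' {j | j < i})).colon {h i}) := by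
  classical
  -- The order dual puts lexicographically larger exponents first.
  let e : (Fin s → ℕ) ≃ (Lex (Fin s → ℕ))ᵒᵈ := toLex.trans OrderDual.toDual
  let g : (Lex (Fin s → ℕ))ᵒᵈ → R := fun v => ∏ i, f i ^ (e.symm v) i
  have key : ∀ u : Fin s → ℕ, Ideal.span (g '' {v | v ∈ (boundedExponents m a).map e.toEmbedding ∧
      v < e u}) = lexLargerIdeal f m a u := by
    intro u
    unfold lexLargerIdeal
    congr 1
    ext x
    constructor
    · rintro ⟨v, ⟨hv, hvu⟩, rfl⟩
      exact ⟨e.symm v, ⟨by simpa using hv, hvu⟩, rfl⟩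
    · rintro ⟨v, ⟨hv, hvu⟩, rfl⟩
      exact ⟨e v, ⟨by simpa using hv, hvu⟩, rfl⟩
  obtain ⟨r, h, h1, h2, h3, h4⟩ :=
    exists_thinned_generators ((boundedExponents m a).map e.toEmbedding) g P (by
      intro u hu hgu
      obtain ⟨u, rfl⟩ := e.surjective u
      rw [key] at hgu ⊢
      exact hP u (by simpa using hu) hgu)
  refine ⟨r, h, h1, fun i => ?_, ?_, h4⟩
  · obtain ⟨u, -, hu⟩ := h2 i
    exact ⟨e.symm u, hu⟩
  · rw [h3, foldProductIdeal_eq_span_image]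
    congr 1
    ext x
    constructor
    · rintro ⟨v, hv, rfl⟩
      exact ⟨e.symm v, by simpa using hv, rfl⟩
    · rintro ⟨v, hv, rfl⟩
      exact ⟨e v, by simpa using hv, rfl⟩

/-! ### Projective dimension bounds the number of raisable indices -/

open scoped Pointwise

universe v

/-- `M` has a resolution of length `p` by modules on which `rs` is weakly regular. -/
def HasRegularResolution {R : Type v} [CommRing R] (rs : List R) :
    ℕ → ∀ (M : Type v) [AddCommGroup M] [Module R M], Prop
  | 0, M, _, _ => RingTheory.Sequence.IsWeaklyRegular M rs
  | p + 1, M, _, _ => ∃ (N F : Type v) (_ : AddCommGroup N) (_ : Module R N)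
      (_ : AddCommGroup F) (_ : Module R F) (i : N →ₗ[R] F) (q : F →ₗ[R] M),
      Function.Injective i ∧ Function.Exact i q ∧ Function.Surjective q ∧
      RingTheory.Sequence.IsWeaklyRegular F rs ∧ HasRegularResolution rs p N

/-- Reduction modulo `x` keeps the resolution exact because `x` is regular on `M`; the syzygy `N`
inherits regularity of `x` from `F`. -/
theorem HasRegularResolution.quotSMulTop {R : Type v} [CommRing R] {x : R} {rs : List R} {p : ℕ}
    {M : Type v} [AddCommGroup M] [Module R M] (hx : IsSMulRegular M x)
    (h : HasRegularResolution (x :: rs) p M) : HasRegularResolution rs p (QuotSMulTop x M) := by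
  induction p generalizing M with
  | zero => exact ((RingTheory.Sequence.isWeaklyRegular_cons_iff M x rs).1 h).2
  | succ p ih =>
    obtain ⟨N, F, _, _, _, _, i, q, hi, hiq, hq, hF, hN⟩ := h
    rw [RingTheory.Sequence.isWeaklyRegular_cons_iff] at hF
    refine ⟨_, _, _, _, _, _, QuotSMulTop.map x i, QuotSMulTop.map x q, ?_, ?_, ?_, hF.2,
      ih (hF.1.of_injective i hi) hN⟩
    · have h0 : Function.Exact (0 : PUnit.{v + 1} →ₗ[R] N) i := by
        intro y
        rw [← LinearMap.map_zero i, hi.eq_iff]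
        simp [eq_comm]
      have h1 := QuotSMulTop.map_first_exact_on_four_term_exact_of_isSMulRegular_last h0 hiq hx
      rw [injective_iff_map_eq_zero]
      intro y hy
      obtain ⟨z, rfl⟩ := (h1 y).1 hy
      simp
    · exact QuotSMulTop.map_exact x hiq hq
    · exact QuotSMulTop.map_surjective x hq

/-- A weakly regular sequence that is longer than a resolution of `M` by modules on which it is
weakly regular kills no nonzero element of `M`. -/
theorem HasRegularResolution.eq_zero_of_smul_eq_zero {R : Type v} [CommRing R] {rs : List R}
    {p : ℕ} {M : Type v} [AddCommGroup M] [Module R M] (h : HasRegularResolution rs p M)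
    (hp : p < rs.length) (w : M) (hw : ∀ x ∈ rs, x • w = 0) : w = 0 := by
  induction p generalizing M rs with
  | zero =>
    match rs, hp with
    | x :: rs, _ =>
      exact ((RingTheory.Sequence.isWeaklyRegular_cons_iff M x rs).1 h).1.right_eq_zero_of_smul
        (hw x (by simp))
  | succ p ih =>
    match rs, hp with
    | x :: rs, hp =>
      obtain ⟨N, F, _, _, _, _, i, q, hi, hiq, hq, hF, hN⟩ := h
      rw [RingTheory.Sequence.isWeaklyRegular_cons_iff] at hF
      obtain ⟨w, rfl⟩ := hq w
      have hlift : ∀ y ∈ x :: rs, ∃ n, i n = y • w := fun y hy =>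
        (hiq (y • w)).1 (by rw [map_smul, hw y hy])
      obtain ⟨n, hn⟩ := hlift x (by simp)
      -- With `x • w = i n`, the class of `n` in `N ⧸ xN` is killed by the remaining elements, so
      -- induction gives `n ∈ xN`; cancelling `x` in `F` then puts `w` in the image of `i`.
      have h0 : (x • (⊤ : Submodule R N)).mkQ n = 0 := by
        refine ih (hN.quotSMulTop (hF.1.of_injective i hi)) (by simpa using hp) _ ?_
        intro y hy
        obtain ⟨n', hn'⟩ := hlift y (by simp [hy])
        have : y • n = x • n' := hi (by rw [map_smul, map_smul, hn, hn', smul_comm])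
        rw [← map_smul, this]
        exact (Submodule.Quotient.mk_eq_zero _).2
          (Submodule.smul_mem_pointwise_smul _ _ _ Submodule.mem_top)
      rw [Submodule.mkQ_apply, Submodule.Quotient.mk_eq_zero,
        Submodule.mem_smul_pointwise_iff_exists] at h0
      obtain ⟨n', -, rfl⟩ := h0
      rw [map_smul] at hn
      rw [← hF.1 hn]
      exact (hiq _).2 ⟨n', rfl⟩

theorem isWeaklyRegular_of_flat {R : Type v} [CommRing R] {rs : List R}
    (h : RingTheory.Sequence.IsWeaklyRegular R rs) (F : Type v) [AddCommGroup F] [Module R F]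
    [Module.Flat R F] : RingTheory.Sequence.IsWeaklyRegular F rs :=
  ((TensorProduct.rid R F).isWeaklyRegular_congr rs).1 (h.isWeaklyRegular_lTensor (M₂ := F))

theorem HasRegularResolution.of_hasProjectiveDimensionLE {R : Type v} [CommRing R] {rs : List R}
    (hrs : RingTheory.Sequence.IsWeaklyRegular R rs) (p : ℕ) (M : ModuleCat.{v} R)
    (h : HasProjectiveDimensionLE M p) : HasRegularResolution rs p M := by
  induction p generalizing M with
  | zero =>
    rw [← projective_iff_hasProjectiveDimensionLE_zero, ← IsProjective.iff_projective] at h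
    exact isWeaklyRegular_of_flat hrs M
  | succ p ih =>
    have hS := M.shortExact_projectiveShortComplex
    have hK := (hS.hasProjectiveDimensionLT_X₃_iff p inferInstance).1 h
    exact ⟨_, _, _, _, _, _, M.projectiveShortComplex.f.hom, M.projectiveShortComplex.g.hom,
      (ModuleCat.mono_iff_injective _).1 hS.mono_f,
      (ShortComplex.ShortExact.moduleCat_exact_iff_function_exact _).1 hS.exact,
      (ModuleCat.epi_iff_surjective _).1 hS.epi_g,
      isWeaklyRegular_of_flat hrs _, ih _ hK⟩

theorem HasRegularResolution.quotient_of_ideal {R : Type v} [CommRing R] {rs : List R}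
    (hrs : RingTheory.Sequence.IsWeaklyRegular R rs) {p : ℕ} {I : Ideal R}
    (h : HasRegularResolution rs p I) : HasRegularResolution rs (p + 1) (R ⧸ I) :=
  ⟨I, R, _, _, _, _, I.subtype, I.mkQ, Subtype.val_injective,
    LinearMap.exact_subtype_mkQ I, Submodule.mkQ_surjective I, hrs, h⟩

theorem isWeaklyRegular_map_X {K σ : Type*} [Field K] (l : List σ) (hl : l.Nodup) :
    RingTheory.Sequence.IsWeaklyRegular (MvPolynomial σ K)
      (l.map (MvPolynomial.X : σ → MvPolynomial σ K)) := by
  refine ⟨fun i hi => ?_⟩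
  rw [isSMulRegular_quotient_iff_mem_of_smul_mem]
  have e : (Ideal.ofList ((l.map (MvPolynomial.X : σ → MvPolynomial σ K)).take i) • ⊤ :
      Submodule (MvPolynomial σ K) (MvPolynomial σ K)) =
      Ideal.span (MvPolynomial.X '' {j | j ∈ l.take i}) := by
    rw [smul_eq_mul, Ideal.mul_top, ← List.map_take]
    unfold Ideal.ofList
    congr 1
    ext r
    exact List.mem_map
  rw [e]
  simp only [List.getElem_map, smul_eq_mul]
  intro g hg
  rw [MvPolynomial.mem_ideal_span_X_image] at hg ⊢
  intro d hd
  simp only [List.length_map] at hi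
  have hnot : l[i] ∉ l.take i := by
    intro h
    obtain ⟨k, hk, hkl⟩ := List.getElem_of_mem h
    rw [List.length_take] at hk
    rw [List.getElem_take] at hkl
    have := (hl.getElem_inj_iff).1 hkl
    omega
  obtain ⟨j, hj, hjd⟩ := hg (Finsupp.single l[i] 1 + d) (by
    rw [MvPolynomial.mem_support_iff, MvPolynomial.coeff_X_mul]
    exact MvPolynomial.mem_support_iff.1 hd)
  refine ⟨j, hj, ?_⟩
  have : j ≠ l[i] := fun h => hnot (h ▸ hj)
  simpa [Finsupp.single_apply, this.symm] using hjd

theorem card_raisableIndices_le_of_projectiveDimension_le {K : Type*} [Field K] {s : ℕ}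
    {m : Fin s → ℕ} {a c : ℕ}
    (h : projectiveDimension (ModuleCat.of (MvPolynomial (Fin s) K)
      (foldProductIdeal (fun i : Fin s => (MvPolynomial.X i : MvPolynomial (Fin s) K)) m a)) ≤
        (c : WithBot ℕ∞)) {u : Fin s → ℕ} (hu : u ∈ boundedExponents m a) :
    (raisableIndices m u).card ≤ c := by
  by_contra! hc
  set J := raisableIndices m u with hJ
  set X : Fin s → MvPolynomial (Fin s) K := MvPolynomial.X with hX
  set I := foldProductIdeal X m a with hI
  have hne : J.Nonempty := Finset.card_pos.1 (by omega)
  obtain ⟨-, l, hl, hul⟩ := (Finset.mem_filter.1 (J.max'_mem hne)).2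
  have hlt : ∀ j ∈ J, j < l := fun j hj => (J.le_max' j hj).trans_lt hl
  have hlJ : l ∉ J := fun h => lt_irrefl _ (hlt l h)
  have hmemI : ∀ v ∈ boundedExponents m a, ∏ i, X i ^ v i ∈ I := by
    intro v hv
    rw [hI, foldProductIdeal_eq_span_image]
    exact Ideal.subset_span ⟨v, hv, rfl⟩
  obtain ⟨w, hw⟩ := exists_eq_add_single hul
  have hlist : RingTheory.Sequence.IsWeaklyRegular (MvPolynomial (Fin s) K)
      ((insert l J).toList.map X) := isWeaklyRegular_map_X _ (Finset.nodup_toList _)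
  have hres := (HasRegularResolution.of_hasProjectiveDimensionLE hlist c _
    ((projectiveDimension_le_iff _ _).1 h)).quotient_of_ideal hlist
  have hzero := hres.eq_zero_of_smul_eq_zero (by
    rw [List.length_map, Finset.length_toList, Finset.card_insert_of_notMem hlJ]; omega)
    (Ideal.Quotient.mk I (∏ i, X i ^ w i)) (by
      intro x hx
      obtain ⟨j, hj, rfl⟩ := List.mem_map.1 hx
      rw [Finset.mem_toList, Finset.mem_insert] at hj
      change Ideal.Quotient.mk I (X j * ∏ i, X i ^ w i) = 0
      rw [Ideal.Quotient.eq_zero_iff_mem]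
      rcases hj with rfl | hj
      · rw [← prod_pow_add_single, ← hw]
        exact hmemI u hu
      · have hjm := (Finset.mem_filter.1 hj).2.1
        rw [hw] at hu hjm
        rw [← prod_pow_add_single]
        exact hmemI _ (add_single_mem_boundedExponents hu (hlt j hj).ne
          (by simpa [(hlt j hj).ne] using hjm)))
  rw [Ideal.Quotient.eq_zero_iff_mem] at hzero
  -- Sending every variable to `X` maps the ideal into `(X ^ a)`, but maps the monomial of exponent
  -- `w` to `X ^ (a - 1)`.
  let φ : MvPolynomial (Fin s) K →ₐ[K] Polynomial K := MvPolynomial.aeval fun _ => Polynomial.X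
  have hφ : ∀ v : Fin s → ℕ, φ (∏ i, X i ^ v i) = Polynomial.X ^ ∑ i, v i := by
    intro v
    simp [φ, hX, Finset.prod_pow_eq_pow_sum]
  have hle : I ≤ (Ideal.span {(Polynomial.X : Polynomial K) ^ a}).comap φ := by
    rw [hI, foldProductIdeal_eq_span_image, Ideal.span_le]
    rintro _ ⟨v, hv, rfl⟩
    rw [SetLike.mem_coe, Ideal.mem_comap, hφ, (mem_boundedExponents.1 hv).2]
    exact Ideal.mem_span_singleton_self _
  have hdvd := Ideal.mem_span_singleton.1 (hle hzero)
  rw [hφ, pow_dvd_pow_iff Polynomial.X_ne_zero Polynomial.not_isUnit_X] at hdvd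
  have h2 := (mem_boundedExponents.1 hu).2
  rw [hw] at h2
  simp [Finset.sum_add_distrib] at h2
  omega

/-! ### Powers of regular families and quasi-regularity -/

/-- Raise the exponent by one: induction writes `g = q' + f k ^ b * t'`. Cancelling `f k ^ b` gives
`t' * f i ∈ (S, f k)`, hence `t' ∈ (S, f k)`. -/
theorem IsRegularUpTo.mem_of_mul_mem_sup_span_pow {R ι : Type*} [CommRing R] [DecidableEq ι]
    {c : ℕ} {f : ι → R} (hf : IsRegularUpTo c f) {S : Finset ι} {i k : ι} (hi : i ∉ insert k S)
    (hk : k ∉ S) (hS : (insert k S).card ≤ c) (b : ℕ) {g : R}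
    (hg : g * f i ∈ Ideal.span (f '' S) ⊔ Ideal.span {f k ^ b}) :
    g ∈ Ideal.span (f '' S) ⊔ Ideal.span {f k ^ b} := by
  induction b generalizing g with
  | zero => simp
  | succ b ih =>
    have hmono : Ideal.span {f k ^ (b + 1)} ≤ Ideal.span {f k ^ b} :=
      Ideal.span_singleton_le_span_singleton.2 (pow_dvd_pow _ (Nat.le_succ b))
    have h1 := ih (sup_le_sup_left hmono _ hg)
    obtain ⟨q, hq, x, hx, hqx⟩ := Submodule.mem_sup.1 hg
    obtain ⟨x', rfl⟩ := Ideal.mem_span_singleton.1 hx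
    obtain ⟨q', hq', t, ht, rfl⟩ := Submodule.mem_sup.1 h1
    obtain ⟨t', rfl⟩ := Ideal.mem_span_singleton.1 ht
    rw [Finset.card_insert_of_notMem hk] at hS
    have h2 : (t' * f i - x' * f k) * f k ^ b ∈ Ideal.span (f '' S) := by
      convert Ideal.sub_mem _ hq (Ideal.mul_mem_right (f i) _ hq') using 1
      linear_combination -hqx
    have h3 := hf.mem_of_mul_pow hk (by omega) b h2
    have hspan : Ideal.span (f '' (insert k S : Finset ι)) =
        Ideal.span (f '' S) ⊔ Ideal.span {f k} := by
      rw [Finset.coe_insert, Set.image_insert_eq, Ideal.span_insert, sup_comm]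
    have h4 : t' ∈ Ideal.span (f '' S) ⊔ Ideal.span {f k} := by
      rw [← hspan]
      refine hf _ i hi (by rw [Finset.card_insert_of_notMem hk]; omega) _ ?_
      rw [hspan]
      have : t' * f i = (t' * f i - x' * f k) + x' * f k := by ring
      rw [this]
      exact Submodule.add_mem_sup h3 (Ideal.mul_mem_left _ _ (Ideal.mem_span_singleton_self _))
    obtain ⟨q₂, hq₂, z, hz, rfl⟩ := Submodule.mem_sup.1 h4
    obtain ⟨z', rfl⟩ := Ideal.mem_span_singleton.1 hz
    have : q' + f k ^ b * (q₂ + f k * z') = (q' + f k ^ b * q₂) + f k ^ (b + 1) * z' := by ring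
    rw [this]
    exact Submodule.add_mem_sup (Ideal.add_mem _ hq' (Ideal.mul_mem_left _ _ hq₂))
      (Ideal.mul_mem_right _ _ (Ideal.mem_span_singleton_self _))

theorem IsRegularUpTo.update_pow {R ι : Type*} [CommRing R] [DecidableEq ι] {c : ℕ} {f : ι → R}
    (hf : IsRegularUpTo c f) (k : ι) (b : ℕ) :
    IsRegularUpTo c (Function.update f k (f k ^ b)) := by
  have himage : ∀ S : Finset ι, k ∉ S → Function.update f k (f k ^ b) '' S = f '' S := by
    intro S hS
    refine Set.image_congr fun j hj => Function.update_of_ne ?_ _ _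
    rintro rfl
    exact hS hj
  intro S i hi hS g hg
  by_cases hkS : k ∈ S
  · have hik : i ≠ k := fun h => hi (h ▸ hkS)
    rw [Function.update_of_ne hik] at hg
    have hspan : Ideal.span (Function.update f k (f k ^ b) '' S) =
        Ideal.span (f '' (S.erase k)) ⊔ Ideal.span {f k ^ b} := by
      conv_lhs => rw [← Finset.insert_erase hkS]
      rw [Finset.coe_insert, Set.image_insert_eq, Ideal.span_insert, sup_comm,
        himage _ (by simp), Function.update_self]
    rw [hspan] at hg ⊢
    rw [← Finset.insert_erase hkS] at hi hS
    exact hf.mem_of_mul_mem_sup_span_pow hi (by simp) hS b hg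
  · rw [himage S hkS] at hg ⊢
    by_cases hik : i = k
    · subst hik
      rw [Function.update_self] at hg
      exact hf.mem_of_mul_pow hi hS b hg
    · rw [Function.update_of_ne hik] at hg
      exact hf S i hi hS g hg

theorem ite_insert_eq_update {R ι : Type*} [CommRing R] [DecidableEq ι] (f : ι → R) (b : ι → ℕ)
    {T : Finset ι} {k : ι} (hk : k ∉ T) :
    (fun i => if i ∈ insert k T then f i ^ b i else f i) =
      Function.update (fun i => if i ∈ T then f i ^ b i else f i) k
        ((fun i => if i ∈ T then f i ^ b i else f i) k ^ b k) := by
  ext i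
  by_cases h : i = k
  · subst h; simp [hk]
  · simp [h]

theorem IsRegularUpTo.ite_pow {R ι : Type*} [CommRing R] [DecidableEq ι] {c : ℕ} {f : ι → R}
    (hf : IsRegularUpTo c f) (b : ι → ℕ) (T : Finset ι) :
    IsRegularUpTo c fun i => if i ∈ T then f i ^ b i else f i := by
  induction T using Finset.induction_on with
  | empty => simpa using hf
  | insert k T hk ih =>
    rw [ite_insert_eq_update f b hk]
    exact ih.update_pow k (b k)

/-- Strip one index at a time: `f k ^ b k` cancels modulo the other generators, some of them powers,
lowering `f k ^ (b k + 1)` to `f k`. -/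
theorem IsRegularUpTo.mem_span_range_of_mul_prod_pow {R ι : Type*} [CommRing R] [Fintype ι]
    [DecidableEq ι] {c : ℕ} {f : ι → R} (hf : IsRegularUpTo c f) (hc : Fintype.card ι ≤ c + 1)
    (b : ι → ℕ) (T : Finset ι) {g : R}
    (hg : g * ∏ i ∈ T, f i ^ b i ∈
      Ideal.span (Set.range fun i => if i ∈ T then f i ^ (b i + 1) else f i)) :
    g ∈ Ideal.span (Set.range f) := by
  induction T using Finset.induction_on with
  | empty => simpa using hg
  | insert k T hk ih =>
    refine ih ?_
    set F : ι → R := fun i => if i ∈ T then f i ^ (b i + 1) else f i with hF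
    have hFr : IsRegularUpTo c F := hf.ite_pow (fun i => b i + 1) T
    have hFk : F k = f k := by simp [hF, hk]
    have hrange : ∀ G : ι → R, (∀ i, i ≠ k → G i = F i) → Ideal.span (Set.range G) =
        Ideal.span (F '' (Finset.univ.erase k : Finset ι)) ⊔ Ideal.span {G k} := by
      intro G hG
      have huniv : Set.univ = insert k ((Finset.univ.erase k : Finset ι) : Set ι) := by
        rw [← Finset.coe_insert, Finset.insert_erase (Finset.mem_univ k), Finset.coe_univ]
      rw [← Set.image_univ, huniv, Set.image_insert_eq, Ideal.span_insert, sup_comm]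
      congr 2
      exact Set.image_congr fun i hi => hG i (by simpa using hi)
    rw [hrange _ (by intro i hi; simp [hF, hi]), Finset.prod_insert hk] at hg
    simp only [Finset.mem_insert_self, if_true] at hg
    rw [hrange F (fun _ _ => rfl), hFk]
    obtain ⟨q, hq, x, hx, hqx⟩ := Submodule.mem_sup.1 hg
    obtain ⟨x', rfl⟩ := Ideal.mem_span_singleton.1 hx
    have h1 : (g * ∏ i ∈ T, f i ^ b i - x' * f k) * F k ^ b k ∈
        Ideal.span (F '' (Finset.univ.erase k : Finset ι)) := by
      convert hq using 1
      rw [hFk]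
      linear_combination -hqx
    have h2 := hFr.mem_of_mul_pow (by simp) (by
      rw [Finset.card_erase_of_mem (Finset.mem_univ k), Finset.card_univ]; omega) _ h1
    have : g * ∏ i ∈ T, f i ^ b i = (g * ∏ i ∈ T, f i ^ b i - x' * f k) + x' * f k := by ring
    rw [this]
    exact Submodule.add_mem_sup h2 (Ideal.mul_mem_left _ _ (Ideal.mem_span_singleton_self _))

/-- Quasi-regularity: the coefficients of a homogeneous relation lie in the ideal. -/
theorem IsRegularUpTo.coeff_mem_of_eval_eq_zero {R ι : Type*} [CommRing R] [Fintype ι] {c : ℕ}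
    {y : ι → R} (hy : IsRegularUpTo c y) (hc : Fintype.card ι ≤ c + 1) {a : ℕ}
    {P : MvPolynomial ι R} (hP : P.IsHomogeneous a) (hPy : MvPolynomial.eval y P = 0)
    (b : ι →₀ ℕ) : P.coeff b ∈ Ideal.span (Set.range y) := by
  classical
  by_cases hb : P.coeff b = 0
  · rw [hb]; exact Ideal.zero_mem _
  have hbs : b ∈ P.support := MvPolynomial.mem_support_iff.2 hb
  refine hy.mem_span_range_of_mul_prod_pow hc b Finset.univ ?_
  rw [MvPolynomial.eval_eq', ← Finset.add_sum_erase _ _ hbs] at hPy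
  rw [eq_neg_of_add_eq_zero_left hPy]
  refine Ideal.neg_mem_iff _ |>.2 (Ideal.sum_mem _ fun d hd => Ideal.mul_mem_left _ _ ?_)
  have hdb := Finset.ne_of_mem_erase hd
  have hdeg : ∑ i, d i = ∑ i, b i := by
    have h1 := hP (MvPolynomial.mem_support_iff.1 (Finset.mem_of_mem_erase hd))
    have h2 := hP hb
    simp only [Finsupp.weight_apply, Pi.one_apply, smul_eq_mul, mul_one] at h1 h2
    rw [Finsupp.sum_fintype _ _ fun _ => rfl] at h1 h2
    rw [h1, h2]
  -- Distinct exponents of equal degree: every other monomial of `P` is divisible by some `y i ^ (b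
  -- i + 1)`.
  have : ∃ i, b i < d i := by
    by_contra! h
    exact hdb (Finsupp.ext fun i =>
      (Finset.sum_eq_sum_iff_of_le fun i _ => h i).1 hdeg i (Finset.mem_univ i))
  obtain ⟨i, hi⟩ := this
  refine Ideal.mem_of_dvd _ ?_ (Ideal.subset_span ⟨i, rfl⟩)
  simp only [Finset.mem_univ, if_true]
  exact (pow_dvd_pow _ hi).trans (Finset.dvd_prod_of_mem _ (Finset.mem_univ i))

/-- If `g ∉ (y)`, a `K`-linear functional vanishing on `(y)` but not at `g` turns the relation into
a linear one over `K`: by quasi-regularity it kills every coefficient of `g F₀ - ∑ r_v F_v`. Thus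
`F₀` is a `K`-combination of the `F v`, against `hF₀'`. -/
theorem IsRegularUpTo.mem_span_range_of_mul_aeval_mem {K R ι κ : Type*} [Field K] [CommRing R]
    [Algebra K R] [Fintype ι] {c : ℕ} {y : ι → R} (hy : IsRegularUpTo c y)
    (hc : Fintype.card ι ≤ c + 1) {a : ℕ} {F : κ → MvPolynomial ι K} {F₀ : MvPolynomial ι K}
    {S : Finset κ} (hF : ∀ v ∈ S, (F v).IsHomogeneous a) (hF₀ : F₀.IsHomogeneous a) {g : R}
    (hg : g * MvPolynomial.aeval y F₀ ∈ Ideal.span ((fun v => MvPolynomial.aeval y (F v)) '' S))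
    (hF₀' : MvPolynomial.aeval y F₀ ∉ Ideal.span ((fun v => MvPolynomial.aeval y (F v)) '' S)) :
    g ∈ Ideal.span (Set.range y) := by
  by_contra hgy
  obtain ⟨r, hr⟩ := (Submodule.mem_span_image_finset_iff_exists_fun' R).1 hg
  obtain ⟨φ, hφg, hφ⟩ := Submodule.exists_le_ker_of_notMem
    (p := (Ideal.span (Set.range y)).restrictScalars K) (v := g) hgy
  set P : MvPolynomial ι R := MvPolynomial.C g * MvPolynomial.map (algebraMap K R) F₀ -
    ∑ v ∈ S, MvPolynomial.C (r v) * MvPolynomial.map (algebraMap K R) (F v) with hPdef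
  have hmap : ∀ G : MvPolynomial ι K, G.IsHomogeneous a → ∀ x : R,
      (MvPolynomial.C x * MvPolynomial.map (algebraMap K R) G).IsHomogeneous a := by
    intro G hG x
    simpa using (MvPolynomial.isHomogeneous_C ι x).mul (hG.map (algebraMap K R))
  have hP : P.IsHomogeneous a := (hmap _ hF₀ g).sub
    (MvPolynomial.IsHomogeneous.sum _ _ _ fun v hv => hmap _ (hF v hv) _)
  have hPy : MvPolynomial.eval y P = 0 := by
    simp only [hPdef, map_sub, map_mul, map_sum, MvPolynomial.eval_C, MvPolynomial.eval_map,
      ← MvPolynomial.aeval_def]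
    rw [← hr, sub_eq_zero]
    simp
  have hcoeff : F₀ = ∑ v ∈ S, ((φ g)⁻¹ * φ (r v)) • F v := by
    ext b
    have h := hφ (hy.coeff_mem_of_eval_eq_zero hc hP hPy b)
    rw [LinearMap.mem_ker, hPdef, MvPolynomial.coeff_sub, MvPolynomial.coeff_sum] at h
    simp only [MvPolynomial.coeff_C_mul, MvPolynomial.coeff_map] at h
    have hcomm : ∀ (x : R) (k : K), φ (x * algebraMap K R k) = k * φ x := by
      intro x k
      rw [mul_comm, ← Algebra.smul_def, map_smul, smul_eq_mul]
    rw [map_sub, map_sum, hcomm, sub_eq_zero] at h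
    simp only [hcomm] at h
    rw [MvPolynomial.coeff_sum]
    simp only [MvPolynomial.coeff_smul, smul_eq_mul]
    rw [eq_div_of_mul_eq hφg h, Finset.sum_div]
    exact Finset.sum_congr rfl fun v _ => by ring
  apply hF₀'
  rw [hcoeff, map_sum]
  refine Ideal.sum_mem _ fun v hv => ?_
  rw [map_smul, Algebra.smul_def]
  exact Ideal.mul_mem_left _ _ (Ideal.subset_span ⟨v, hv, rfl⟩)

/-! ### Colon ideals for generic families and the conclusion -/

/-- A dependence would put some `f i` in the ideal of the others; cancelling `f i` then makes that
ideal the unit ideal. -/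
theorem IsCGeneric.linearIndependent {K R : Type*} [Field K] [CommRing R] [Algebra K R] {s c : ℕ}
    {f : Fin s → R} (hf : IsCGeneric c f) {S : Finset (Fin s)} (hS : S.card ≤ c + 1) :
    LinearIndependent K fun i : S => f i := by
  rw [linearIndependent_iff_notMem_span]
  rintro ⟨i, hi⟩ h
  have hle : (Set.univ \ {(⟨i, hi⟩ : S)}).image (fun i : S => f i) ⊆
      f '' (S.erase i : Finset (Fin s)) := by
    rintro _ ⟨⟨j, hj⟩, hji, rfl⟩
    exact ⟨j, by simpa [hj] using hji, rfl⟩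
  have h1 : f i ∈ Ideal.span (f '' (S.erase i : Finset (Fin s))) :=
    Submodule.span_le_restrictScalars K R _ (Submodule.span_mono hle h)
  have hcard := Finset.card_erase_of_mem hi
  have h2 := hf.isRegularUpTo (S.erase i) i (by simp) (by omega) 1 (by simpa using h1)
  exact hf.span_ne_top (by omega) ((Ideal.eq_top_iff_one _).2 h2)

theorem IsRegularUpTo.comp_injective {R ι κ : Type*} [CommRing R] {c : ℕ} {f : ι → R}
    (hf : IsRegularUpTo c f) (e : κ ↪ ι) : IsRegularUpTo c (f ∘ e) := by
  intro S i hi hS g hg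
  have h := hf (S.map e) (e i) (by simpa using hi) (by simpa using hS) g
  rw [Finset.coe_map, ← Set.image_comp] at h
  exact h hg

theorem IsCGeneric.colon_lexLargerIdeal {R : Type*} [CommRing R] {s c : ℕ}
    {f : Fin s → R} (hf : IsCGeneric c f) {m : Fin s → ℕ} {a : ℕ} {u : Fin s → ℕ}
    (hu : u ∈ boundedExponents m a) (hc : (raisableIndices m u).card ≤ c) :
    (lexLargerIdeal f m a u).colon {∏ i, f i ^ u i} = Ideal.span (f '' raisableIndices m u) := by
  refine le_antisymm (fun g hg => ?_) (Ideal.span_le.2 ?_)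
  · rw [Submodule.mem_colon_singleton] at hg
    exact hf.isRegularUpTo.mem_span_of_mul_mem_lexLargerIdeal hu hc hg
  · rintro _ ⟨j, hj, rfl⟩
    exact Submodule.mem_colon_singleton.2 (mul_prod_mem_lexLargerIdeal f hu hj)

theorem IsCGeneric.colon_lexLargerIdeal_of_finrank {K R : Type*} [Field K] [CommRing R]
    [Algebra K R] {s n : ℕ} {f : Fin s → R} (hf : IsCGeneric n f)
    (hrank : Module.finrank K (Submodule.span K (Set.range f)) = n + 1) {m : Fin s → ℕ} {a : ℕ}
    {u : Fin s → ℕ} (hu : u ∈ boundedExponents m a)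
    (hfu : ∏ i, f i ^ u i ∉ lexLargerIdeal f m a u) {S : Finset (Fin s)}
    (hS : S ⊆ raisableIndices m u) (hcard : S.card = n + 1) :
    (lexLargerIdeal f m a u).colon {∏ i, f i ^ u i} = Ideal.span (f '' S) := by
  refine le_antisymm (fun g hg => ?_) (Ideal.span_le.2 ?_)
  · rw [Submodule.mem_colon_singleton, smul_eq_mul] at hg
    have hspan : Submodule.span K (Set.range fun i : S => f i) =
        Submodule.span K (Set.range f) := by
      have : FiniteDimensional K (Submodule.span K (Set.range f)) :=
        FiniteDimensional.span_of_finite K (Set.finite_range f)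
      refine Submodule.eq_of_le_of_finrank_eq (Submodule.span_mono ?_) ?_
      · rintro _ ⟨i, rfl⟩
        exact ⟨i, rfl⟩
      · rw [finrank_span_eq_card (hf.linearIndependent hcard.le), hrank, Fintype.card_coe, hcard]
    have hlin : ∀ i, ∃ c : S → K, ∑ j, c j • f j = f i := fun i =>
      (Submodule.mem_span_range_iff_exists_fun K).1
        (hspan ▸ Submodule.subset_span (Set.mem_range_self i))
    choose c hc using hlin
    -- Rewriting each `f i` as a linear form in the chosen basis turns `f^v` into the value of a
    -- degree `a` form over `K`.
    set F : (Fin s → ℕ) → MvPolynomial S K := fun v =>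
      ∏ i, (∑ j, MvPolynomial.C (c i j) * MvPolynomial.X j) ^ v i with hF
    have hFhom : ∀ v ∈ boundedExponents m a, (F v).IsHomogeneous a := by
      intro v hv
      rw [← (mem_boundedExponents.1 hv).2]
      refine MvPolynomial.IsHomogeneous.prod _ _ _ fun i _ => ?_
      have : (∑ j, MvPolynomial.C (c i j) * MvPolynomial.X j :
          MvPolynomial S K).IsHomogeneous 1 :=
        MvPolynomial.IsHomogeneous.sum _ _ _ fun j _ =>
          MvPolynomial.isHomogeneous_C_mul_X (c i j) j
      simpa using this.pow (v i)
    have haeval : ∀ v, MvPolynomial.aeval (fun i : S => f i) (F v) = ∏ i, f i ^ v i := by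
      intro v
      simp only [hF, map_prod, map_pow, map_sum, map_mul, MvPolynomial.aeval_C,
        MvPolynomial.aeval_X, ← Algebra.smul_def, hc]
    classical
    set V := (boundedExponents m a).filter fun v => toLex u < toLex v with hV
    have hideal : lexLargerIdeal f m a u =
        Ideal.span ((fun v => MvPolynomial.aeval (fun i : S => f i) (F v)) '' V) := by
      simp only [haeval, lexLargerIdeal, hV, Finset.coe_filter]
    rw [hideal, ← haeval] at hg hfu
    have h := (hf.isRegularUpTo.comp_injective
      (Function.Embedding.subtype (· ∈ S))).mem_span_range_of_mul_aeval_mem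
      (by rw [Fintype.card_coe, hcard]) (fun v hv => hFhom v (Finset.mem_filter.1 hv).1)
      (hFhom u hu) hg hfu
    rwa [Set.range_comp, Function.Embedding.coe_subtype, Subtype.range_coe_subtype] at h
  · rintro _ ⟨j, hj, rfl⟩
    exact Submodule.mem_colon_singleton.2 (mul_prod_mem_lexLargerIdeal f hu (hS hj))

theorem IsCGeneric.exists_isRegular {R : Type*} [CommRing R] {s c : ℕ} {f : Fin s → R}
    (hf : IsCGeneric c f) {S : Finset (Fin s)} (hS : S.card ≤ c + 1) :
    ∃ l : List R, (∀ p ∈ l, ∃ i, p = f i) ∧ RingTheory.Sequence.IsRegular R l ∧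
      Ideal.ofList l = Ideal.span (f '' S) := by
  refine ⟨S.toList.map f, fun p hp => ?_, hf _ S.nodup_toList (by simpa using hS), ?_⟩
  · obtain ⟨i, -, rfl⟩ := List.mem_map.1 hp
    exact ⟨i, rfl⟩
  · rw [ofList_map_eq_span]
    simp

theorem isForm_prod_pow {K σ : Type*} [Field K] {s : ℕ} {f : Fin s → MvPolynomial σ K}
    (hf : ∀ i, IsForm (f i)) (u : Fin s → ℕ) : IsForm (∏ i, f i ^ u i) := by
  choose e he using hf
  exact ⟨_, MvPolynomial.IsHomogeneous.prod _ _ _ fun i _ => (he i).pow (u i)⟩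

theorem mainTheorem1 {K : Type*} [Field K] (n s : ℕ)
    (f : Fin s → MvPolynomial (Fin (n + 1)) K) (hf : ∀ i, IsForm (f i))
    (a : ℕ) (m : Fin s → ℕ) (ha : 0 < a) (hm : ∀ i, 0 < m i) (ham : a ≤ ∑ i, m i) :
    (∀ d : ℕ, IsStronglyGeneric d f →
      HasCIQuotientsOfDegree d (foldProductIdeal f m a)) ∧
    (∀ c : ℕ,
      projectiveDimension (ModuleCat.of (MvPolynomial (Fin s) K)
        (foldProductIdeal (fun i : Fin s => (MvPolynomial.X i : MvPolynomial (Fin s) K)) m a)) ≤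
          (c : WithBot ℕ∞) →
      c ≤ n → IsCGeneric c f →
        HasCIQuotients (foldProductIdeal f m a) ∧
        ∀ d : ℕ, (∀ i, (f i).IsHomogeneous d) →
          HasCIQuotientsOfDegree d (foldProductIdeal f m a)) := by
  have hform : ∀ {x}, (∃ u : Fin s → ℕ, x = ∏ j, f j ^ u j) → IsForm x := by
    rintro _ ⟨u, rfl⟩
    exact isForm_prod_pow hf u
  refine ⟨fun d hd => ?_, fun c hpd _ hgen => ⟨?_, fun d hd => ?_⟩⟩
  · obtain ⟨r, h, h1, h2, h3, h4⟩ :=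
      exists_generators_of_colon f m a (IsCompleteIntersectionOfDegree d) fun u hu hfu => by
        have hex : ∃ S : Finset (Fin s), S.card ≤ n + 1 ∧
            (lexLargerIdeal f m a u).colon {∏ i, f i ^ u i} = Ideal.span (f '' S) := by
          -- With more than `n` raisable indices, any `n + 1` of them suffice, since the
          -- corresponding `f j` span the whole family.
          by_cases hcard : (raisableIndices m u).card ≤ n
          · exact ⟨_, by omega, hd.generic.colon_lexLargerIdeal hu hcard⟩
          · obtain ⟨S, hS, hSc⟩ := Finset.exists_subset_card_eq (not_le.1 hcard)
            exact ⟨S, hSc.le,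
              hd.generic.colon_lexLargerIdeal_of_finrank hd.finrank_span hu hfu hS hSc⟩
        obtain ⟨S, hS, hcolon⟩ := hex
        obtain ⟨l, hl, hreg, hspan⟩ := hd.generic.exists_isRegular hS
        refine ⟨l, fun p hp => ?_, hreg, hspan.trans hcolon.symm⟩
        obtain ⟨i, rfl⟩ := hl p hp
        exact hd.isHomogeneous i
    exact ⟨r, h, h1, fun i => hform (h2 i), h3, fun i _ => h4 i⟩
  · obtain ⟨r, h, h1, h2, h3, h4⟩ :=
      exists_generators_of_colon f m a IsCompleteIntersection fun u hu _ => by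
        have hcard := card_raisableIndices_le_of_projectiveDimension_le hpd hu
        obtain ⟨l, hl, hreg, hspan⟩ := hgen.exists_isRegular (hcard.trans (Nat.le_succ c))
        refine ⟨l, fun p hp => ?_, hreg, hspan.trans (hgen.colon_lexLargerIdeal hu hcard).symm⟩
        obtain ⟨i, rfl⟩ := hl p hp
        exact hf i
    exact ⟨r, h, h1, fun i => hform (h2 i), h3, fun i _ => h4 i⟩
  · obtain ⟨r, h, h1, h2, h3, h4⟩ :=
      exists_generators_of_colon f m a (IsCompleteIntersectionOfDegree d) fun u hu _ => by
        have hcard := card_raisableIndices_le_of_projectiveDimension_le hpd hu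
        obtain ⟨l, hl, hreg, hspan⟩ := hgen.exists_isRegular (hcard.trans (Nat.le_succ c))
        refine ⟨l, fun p hp => ?_, hreg, hspan.trans (hgen.colon_lexLargerIdeal hu hcard).symm⟩
        obtain ⟨i, rfl⟩ := hl p hp
        exact hd i
    exact ⟨r, h, h1, fun i => hform (h2 i), h3, fun i _ => h4 i⟩
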